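/- **Setting.** A database schema has relations $R_1,\dots,R_m$ with finite attribute sets $\mathbb A_1,\dots,\mathbb A_m$, a domain for each attribute, and a (possibly empty) set of foreign keys. A foreign key consists of attributes that the child relation shares with the parent relation and that form a key of the parent. An instance $\mathcal D$ assigns a finite bag of tuples to each relation. It is *valid* if for each foreign key the referenced attributes are a key of the parent (at most one parent tuple, counted with multiplicity, per key value) and every child tuple refers to an existing parent tuple. One relation $P$ is the *primary private relation*. Valid $\mathcal D$ and $\mathcal D'$ are *neighbours* if one arises from the other by deleting one tuple $t$ of $P$ together with all tuples that depend on $t$, directly or transitively, through foreign keys. Without foreign keys this means deleting one tuple of $P$. A randomized mechanism $\mathcal M$ is *$\epsilon$-DP* if $\Pr[\mathcal M(\mathcal D)\in O]\le e^{\epsilon}\Pr[\mathcal M(\mathcal D')\in O]$ for all neighbours $\mathcal D,\mathcal D'$ (in both orders) and all measurable sets $O$. $Lap(b)$ denotes the Laplace distribution with mean $0$ and density $\frac1{2b}e^{-|x|/b}$, and all noises below are independent. $Q$ is a full conjunctive query without self-joins: the natural join $R_1\Join\cdots\Join R_m$ in bag semantics, each relation used once, possibly with a selection condition on the single tuples of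 each relation. In numerical expressions $Q(\mathcal D)$ stands for the number of output tuples. For a tuple $t$ from the domain of a relation let $$TSens(t,Q,\mathcal D)=\max\big(|Q(\mathcal D\cup\{t\})\,\Delta\,Q(\mathcal D)|,\ |Q(\mathcal D)\,\Delta\,Q(\mathcal D\setminus\{t\})|\big),$$ where one copy of $t$ is added or removed and $\Delta$ is the symmetric difference of bags. For $i\in\mathbb N$ let $T_{TSens}(Q,\mathcal D,i)$ be $\mathcal D$ with all tuples $t$ of $P$ such that $TSens(t,Q,\mathcal D)>i$ removed. **Algorithm.** Parameters: integers $\ell\ge1$ and $\tau_0\ge 1$ (for instance $\tau_0=\ell$), and reals $\epsilon_1,\epsilon_2,\epsilon_3>0$ with $\epsilon_1+\epsilon_2+\epsilon_3=\epsilon_{tsens}<\epsilon$. 1. Release $\hat Q=Q(T_{TSens}(Q,\mathcal D,\ell))+Lap(\ell/\epsilon_1)$. 2. (Sparse vector technique.) Put $q_i=\big(Q(T_{TSens}(Q,\mathcal D,i))-\hat Q\big)/i$ for $i=1,\dots,\ell-1$. Draw $\rho\sim Lap(1/\epsilon_2)$. For $i=1,\dots,\ell-1$ in this order draw a fresh $\nu_i\sim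 Lap(2/\epsilon_3)$, and stop at the first $i$ with $q_i+\nu_i>0+\rho$. Let $\tau$ be this $i$, or $\tau_0$ if there is none. 3. Release $Q(T_{TSens}(Q,\mathcal D,\tau))+Lap\big(\frac{\tau}{\epsilon-\epsilon_{tsens}}\big)$. **Theorem.** For every schema, every choice of the primary private relation $P$, every such query $Q$ and all such parameters: (a) the algorithm that finds the truncation threshold (steps 1 and 2) satisfies $\epsilon_{tsens}$-DP, both when it outputs $(\hat Q,\tau)$ and when it outputs $\tau$ alone; (b) for every fixed integer $\tau\ge1$, releasing $Q(T_{TSens}(Q,\mathcal D,\tau))+Lap\big(\frac{\tau}{\epsilon-\epsilon_{tsens}}\big)$ satisfies $(\epsilon-\epsilon_{tsens})$-DP; (c) the whole mechanism (steps 1 to 3) satisfies $\epsilon$-DP, both when it outputs $\hat Q$, $\tau$ and the noisy answer and when it outputs the noisy answer alone. -/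

import Mathlib

open MeasureTheory

/-! ### Relational databases, keys and foreign keys -/

/-- A foreign key of relation `child` into relation `parent`: the attributes `key`, which the two
relations share, form a key of `parent`, and every `child` tuple refers through them to a
`parent` tuple. -/
structure ForeignKey {Attr : Type*} {Rel : Type*} (attrs : Rel → Finset Attr) where
  child : Rel
  parent : Rel
  key : Finset Attr
  key_child : key ⊆ attrs child
  key_parent : key ⊆ attrs parent

/-- A database schema: finitely many relation names, the finite attribute set of each of them, a
domain for each attribute, and a (possibly empty) set of foreign keys. -/
structure Schema where
  Attr : Type*
  Rel : Type*
  [relFintype : Fintype Rel]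
  dom : Attr → Type*
  attrs : Rel → Finset Attr
  fks : Set (ForeignKey attrs)

attribute [instance] Schema.relFintype

namespace Schema

/-- The full domain of tuples of the relation `i`. -/
abbrev Tuple (S : Schema) (i : S.Rel) := (a : {a // a ∈ S.attrs i}) → S.dom a

/-- A tuple from the domain of any table, together with the table that it is meant for. -/
abbrev TableTuple (S : Schema) := Σ i : S.Rel, S.Tuple i

/-- Tuples over the set of all attributes that occur in the database. -/
abbrev OutTuple (S : Schema) := (a : {a // ∃ i, a ∈ S.attrs i}) → S.dom a

/-- The restriction of an output tuple to the attributes of the relation `i`. -/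
def proj {S : Schema} (x : S.OutTuple) (i : S.Rel) : S.Tuple i := fun a => x ⟨a.1, i, a.2⟩

/-- A database instance under bag semantics: a finite bag of tuples for each relation. -/
abbrev Database (S : Schema) := (i : S.Rel) → Multiset (S.Tuple i)

end Schema

namespace ForeignKey

variable {S : Schema}

/-- The values of a child tuple in the foreign key attributes. -/
def childKey (f : ForeignKey S.attrs) (v : S.Tuple f.child) : (a : {a // a ∈ f.key}) → S.dom a :=
  fun a => v ⟨a.1, f.key_child a.2⟩

/-- The values of a parent tuple in the referenced key attributes. -/
def parentKey (f : ForeignKey S.attrs) (u : S.Tuple f.parent) : (a : {a // a ∈ f.key}) → S.dom a :=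
  fun a => u ⟨a.1, f.key_parent a.2⟩

end ForeignKey

namespace Schema

variable {S : Schema}

open scoped Classical in
/-- `D` respects the foreign keys: referenced attributes form a key of the parent relation (at most
one tuple, with multiplicity one, for each key value), and no reference dangles. With no foreign
keys, every instance is valid. -/
def Valid (D : S.Database) : Prop :=
  ∀ f ∈ S.fks,
    (∀ k, Multiset.card ((D f.parent).filter (fun u => f.parentKey u = k)) ≤ 1) ∧
    (∀ v ∈ D f.child, ∃ u ∈ D f.parent, f.childKey v = f.parentKey u)

/-- In `D`, the tuple `v` refers directly to the tuple `u` through a foreign key. -/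
def RefersTo (D : S.Database) (v u : S.TableTuple) : Prop :=
  ∃ f ∈ S.fks, ∃ v' ∈ D f.child, ∃ u' ∈ D f.parent,
    v = ⟨f.child, v'⟩ ∧ u = ⟨f.parent, u'⟩ ∧ f.childKey v' = f.parentKey u'

open scoped Classical in
/-- `D ∪ {t}`: one more copy of `t`. -/
noncomputable def insertTuple (D : S.Database) (t : S.TableTuple) : S.Database :=
  Function.update D t.1 (t.2 ::ₘ D t.1)

open scoped Classical in
/-- `D \ {t}`: one copy of `t` fewer (`D` itself if `t` is not in `D`). -/
noncomputable def removeTuple (D : S.Database) (t : S.TableTuple) : S.Database :=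
  Function.update D t.1 ((D t.1).erase t.2)

open scoped Classical in
/-- Deletion of `t` with cascading deletion of all tuples that depend on `t`, directly or
transitively, through foreign keys. -/
noncomputable def cascadeDelete (D : S.Database) (t : S.TableTuple) : S.Database :=
  fun j => (removeTuple D t j).filter (fun v => ¬ Relation.TransGen (RefersTo D) ⟨j, v⟩ t)

end Schema

open Schema

/-! ### Full conjunctive queries without self-joins, and tuple sensitivity -/

/-- A full conjunctive query without self-joins: the natural join of all the relations, each of
them used once, with a selection condition on the tuples of each relation (`fun _ _ => True` for
the plain natural join). -/
structure JoinQuery (S : Schema) where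
  sel : (i : S.Rel) → S.Tuple i → Prop

namespace JoinQuery

variable {S : Schema}

open scoped Classical in
/-- The multiplicity of an output tuple in the join (bag semantics). -/
noncomputable def mult (Q : JoinQuery S) (D : S.Database) (x : S.OutTuple) : ℕ :=
  ∏ i, ((D i).filter (Q.sel i)).count (proj x i)

theorem finite_support_mult (Q : JoinQuery S) (D : S.Database) :
    (Function.support (Q.mult D)).Finite := by
  classical
  have hfin : (Set.univ.pi fun i => {t : S.Tuple i | t ∈ D i}).Finite :=
    Set.Finite.pi fun i => ((D i).toFinset.finite_toSet).subset fun t ht => by simpa using ht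
  refine (hfin.preimage (f := fun (x : S.OutTuple) i => proj x i) ?_).subset ?_
  · intro x _ y _ hxy
    funext a
    obtain ⟨a, i, ha⟩ := a
    exact congrFun (congrFun hxy i) ⟨a, ha⟩
  · intro x hx i _
    have h := (Finset.prod_ne_zero_iff.mp hx) i (Finset.mem_univ i)
    exact (Multiset.mem_filter.mp (Multiset.count_ne_zero.mp h)).1

/-- The query result `Q(D)`, a bag of output tuples. -/
noncomputable def result (Q : JoinQuery S) (D : S.Database) : Multiset S.OutTuple :=
  Finsupp.toMultiset (Finsupp.ofSupportFinite (Q.mult D) (Q.finite_support_mult D))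

/-- The answer of the counting query: the number of output tuples. -/
noncomputable def answer (Q : JoinQuery S) (D : S.Database) : ℕ :=
  Multiset.card (Q.result D)

open scoped Classical in
/-- The size of the symmetric difference of two bags. -/
noncomputable def bagDist {α : Type*} (A B : Multiset α) : ℕ :=
  Multiset.card ((A - B) + (B - A))

/-- Upward tuple sensitivity. -/
noncomputable def tsensUp (Q : JoinQuery S) (D : S.Database) (t : S.TableTuple) : ℕ :=
  bagDist (Q.result (insertTuple D t)) (Q.result D)

/-- Downward tuple sensitivity. -/
noncomputable def tsensDown (Q : JoinQuery S) (D : S.Database) (t : S.TableTuple) : ℕ :=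
  bagDist (Q.result D) (Q.result (removeTuple D t))

/-- Tuple sensitivity. -/
noncomputable def tsens (Q : JoinQuery S) (D : S.Database) (t : S.TableTuple) : ℕ :=
  max (Q.tsensUp D t) (Q.tsensDown D t)

open scoped Classical in
/-- Truncation: from the primary private relation `p`, remove the tuples whose sensitivity
exceeds `i`; leave the other relations alone. -/
noncomputable def truncate (Q : JoinQuery S) (p : S.Rel) (D : S.Database) (i : ℕ) : S.Database :=
  fun j => (D j).filter (fun t => j = p → Q.tsens D ⟨j, t⟩ ≤ i)

end JoinQuery

/-! ### Differential privacy -/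

/-- `M` is a randomized mechanism on databases that is `ε`-differentially private with primary
private relation `p`: neighbours of a valid instance arise by deleting one tuple of `p` with
cascading deletion. The two inequalities say that the log-ratio of the probabilities is at most
`ε` in absolute value. -/
def IsDP {S : Schema} {Ω : Type*} [MeasurableSpace Ω] (p : S.Rel) (ε : ℝ)
    (M : S.Database → Measure Ω) : Prop :=
  (∀ D, IsProbabilityMeasure (M D)) ∧
  ∀ (D : S.Database) (t : S.Tuple p), Valid D → t ∈ D p → ∀ O : Set Ω, MeasurableSet O →
    M D O ≤ ENNReal.ofReal (Real.exp ε) * M (cascadeDelete D ⟨p, t⟩) O ∧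
    M (cascadeDelete D ⟨p, t⟩) O ≤ ENNReal.ofReal (Real.exp ε) * M D O

/-- The Laplace distribution with mean `0` and scale `b > 0`. -/
noncomputable def laplace (b : ℝ) : Measure ℝ :=
  volume.withDensity (fun x => ENNReal.ofReal (1 / (2 * b) * Real.exp (-|x| / b)))

/-- The noisy scan of the sparse vector technique for a given noisy threshold `θ`: go through the
labelled query answers in order, add fresh Laplace noise of scale `s` to each of them, stop at the
first one that is above `θ`, and report its label; report `dflt` if there is none. -/
noncomputable def svtScan (s θ : ℝ) (dflt : ℕ) : List (ℕ × ℝ) → Measure ℕ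
  | [] => Measure.dirac dflt
  | (i, q) :: L =>
      (laplace s).bind (fun ν => if q + ν > θ then Measure.dirac i else svtScan s θ dflt L)

/-- The sparse vector technique with threshold `0`, for queries of sensitivity `1`, stopping at the
first positive report: budget `α` for the threshold and `β` for the queries. -/
noncomputable def svt (α β : ℝ) (dflt : ℕ) (L : List (ℕ × ℝ)) : Measure ℕ :=
  (laplace (1 / α)).bind (fun ρ => svtScan (2 / β) (0 + ρ) dflt L)

/-! ### The truncation mechanism -/

namespace JoinQuery

variable {S : Schema}

/-- `Q(T(D, i)) + Lap(i / δ)`. -/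
noncomputable def noisyTruncated (Q : JoinQuery S) (p : S.Rel) (δ : ℝ) (i : ℕ) (D : S.Database) :
    Measure ℝ :=
  (laplace (i / δ)).map (fun η => (Q.answer (Q.truncate p D i) : ℝ) + η)

/-- The labelled queries `q_i = (Q(T(D, i)) - Qhat) / i` for `i = 1, …, ℓ - 1`. -/
noncomputable def svtQueries (Q : JoinQuery S) (p : S.Rel) (ℓ : ℕ) (D : S.Database) (Qhat : ℝ) :
    List (ℕ × ℝ) :=
  (List.range' 1 (ℓ - 1)).map (fun i => (i, ((Q.answer (Q.truncate p D i) : ℝ) - Qhat) / i))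

/-- The procedure that finds the truncation threshold; it outputs `(Qhat, τ)`. Budget `ε₁` goes to
`Qhat`, and `ε₂`, `ε₃` go to the sparse vector technique. -/
noncomputable def findThreshold (Q : JoinQuery S) (p : S.Rel) (ℓ dflt : ℕ) (ε₁ ε₂ ε₃ : ℝ)
    (D : S.Database) : Measure (ℝ × ℕ) :=
  (Q.noisyTruncated p ε₁ ℓ D).bind (fun Qhat =>
    (svt ε₂ ε₃ dflt (Q.svtQueries p ℓ D Qhat)).map (fun τ => (Qhat, τ)))

/-- The whole mechanism: find `τ`, then answer with the remaining budget `δ`. It outputs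
`(Qhat, τ, noisy answer)`. -/
noncomputable def tsensDP (Q : JoinQuery S) (p : S.Rel) (ℓ dflt : ℕ) (ε₁ ε₂ ε₃ δ : ℝ)
    (D : S.Database) : Measure (ℝ × ℕ × ℝ) :=
  (Q.findThreshold p ℓ dflt ε₁ ε₂ ε₃ D).bind (fun z =>
    (Q.noisyTruncated p δ z.2 D).map (fun r => (z.1, z.2, r)))

end JoinQuery

/-! ### Tuple sensitivities and truncated answers -/

namespace JoinQuery

variable {S : Schema}

/-! Since `p` occurs once in the join, the result is additive in the bag of `p` when the other
relations are fixed. Hence the sensitivity of a tuple of `p` is its `contribution`, which does not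
depend on the rest of `p`, and truncation at `i` acts tuple by tuple: the truncated answer is the
sum of the contributions that are at most `i` (`answer_truncate`).

Cascading deletion of `t` changes no other surviving contribution. By the key property, a join
containing a tuple that depends on `t` must itself contain `t`; and if anything depends on `t`, then
`t` has multiplicity one. So no join through another tuple of `p` is affected, and tuples of `p`
deleted along with `t` contribute nothing. The truncated answer therefore drops by a number between
`0` and `i`, for every `i` at once (`answer_truncate_eq_add`, `abs_answer_truncate_sub_le`).

The rest is a privacy calculation with inequalities `μ ≤ c • ν` between measures. A Laplace shift is
paid for by `map_add_laplace_le`. Given `Qhat`, the sparse vector queries have sensitivity `1`, and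
the scan costs its budget once, however many queries it examines (`svtScan_le`, `svt_le`).
`Measure.bind_le_smul` multiplies the factors of successive adaptive stages, and `IsDP.map` discards
the outputs that are not released. -/

theorem count_result (Q : JoinQuery S) [DecidableEq S.OutTuple] (D : S.Database) (x : S.OutTuple) :
    (Q.result D).count x = Q.mult D x := by
  unfold result
  rw [Finsupp.count_toMultiset]
  rfl

open scoped Classical in
theorem mult_update (Q : JoinQuery S) (D : S.Database) (p : S.Rel) (B : Multiset (S.Tuple p))
    (x : S.OutTuple) :
    Q.mult (Function.update D p B) x = (B.filter (Q.sel p)).count (proj x p) *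
      ∏ i ∈ Finset.univ.erase p, ((D i).filter (Q.sel i)).count (proj x i) := by
  unfold mult
  rw [← Finset.mul_prod_erase _ _ (Finset.mem_univ p)]
  congr 1
  · simp
  · refine Finset.prod_congr rfl fun i hi => ?_
    rw [Function.update_of_ne (Finset.ne_of_mem_erase hi)]

open scoped Classical in
-- Without self-joins, the multiplicity of an output tuple has exactly one factor from `p`, and that
-- factor is additive in the bag.
theorem result_update_add (Q : JoinQuery S) (D : S.Database) (p : S.Rel)
    (B C : Multiset (S.Tuple p)) :
    Q.result (Function.update D p (B + C)) =
      Q.result (Function.update D p B) + Q.result (Function.update D p C) := by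
  ext x
  simp only [Multiset.count_add, count_result, mult_update, Multiset.filter_add, add_mul]

open scoped Classical in
/-- The number of output tuples that one copy of the tuple `t` of the relation `p` contributes. -/
noncomputable def contribution (Q : JoinQuery S) (p : S.Rel) (D : S.Database) (t : S.Tuple p) : ℕ :=
  Q.answer (Function.update D p {t})

theorem bagDist_add_left {α : Type*} (A B : Multiset α) :
    bagDist (A + B) B = Multiset.card A := by
  classical
  unfold bagDist
  have h : B - (A + B) = 0 := tsub_eq_zero_of_le (Multiset.le_add_left _ _)
  convert congrArg Multiset.card (show (A + B - B) + (B - (A + B)) = A by simp [h])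

theorem bagDist_self {α : Type*} (A : Multiset α) : bagDist A A = 0 := by
  simpa using bagDist_add_left (0 : Multiset α) A

open scoped Classical in
-- By additivity, inserting a copy of `t` adds its contribution. Removing one loses the same amount
-- if `t` is present and nothing otherwise, so the upward sensitivity attains the maximum.
theorem tsens_eq_contribution (Q : JoinQuery S) (p : S.Rel) (D : S.Database) (t : S.Tuple p) :
    Q.tsens D ⟨p, t⟩ = Q.contribution p D t := by
  have up : Q.tsensUp D ⟨p, t⟩ = Q.contribution p D t := by
    unfold tsensUp insertTuple
    dsimp only
    rw [← Multiset.singleton_add, result_update_add, Function.update_eq_self, bagDist_add_left]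
    rfl
  have down : Q.tsensDown D ⟨p, t⟩ ≤ Q.contribution p D t := by
    unfold tsensDown removeTuple
    dsimp only
    by_cases ht : t ∈ D p
    · have h : Q.result D = Q.result (Function.update D p {t}) +
          Q.result (Function.update D p ((D p).erase t)) := by
        rw [← result_update_add, Multiset.singleton_add, Multiset.cons_erase ht,
          Function.update_eq_self]
      conv_lhs => rw [h]
      rw [bagDist_add_left]
      rfl
    · rw [Multiset.erase_of_notMem ht, Function.update_eq_self, bagDist_self]
      exact Nat.zero_le _
  unfold tsens
  rw [up, max_eq_left down]

open scoped Classical in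
theorem answer_update (Q : JoinQuery S) (D : S.Database) (p : S.Rel) (B : Multiset (S.Tuple p)) :
    Q.answer (Function.update D p B) = (B.map (Q.contribution p D)).sum := by
  induction B using Multiset.induction with
  | empty =>
    -- Additivity at `0 + 0` reads `X = X + X`, which forces the empty result.
    have h := result_update_add Q D p 0 0
    simpa [answer] using h
  | cons t B ih =>
    rw [Multiset.map_cons, Multiset.sum_cons, ← ih, ← Multiset.singleton_add, answer,
      result_update_add, Multiset.card_add]
    rfl

/-- The number of output tuples that one copy of `t` contributes after truncation at `i`. -/
noncomputable def truncContribution (Q : JoinQuery S) (p : S.Rel) (i : ℕ) (D : S.Database)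
    (t : S.Tuple p) : ℕ :=
  if Q.contribution p D t ≤ i then Q.contribution p D t else 0

theorem truncContribution_le (Q : JoinQuery S) (p : S.Rel) (i : ℕ) (D : S.Database)
    (t : S.Tuple p) : Q.truncContribution p i D t ≤ i := by
  unfold truncContribution
  split_ifs with h
  · exact h
  · exact Nat.zero_le _

open scoped Classical in
theorem answer_truncate (Q : JoinQuery S) (p : S.Rel) (D : S.Database) (i : ℕ) :
    Q.answer (Q.truncate p D i) = ((D p).map (Q.truncContribution p i D)).sum := by
  have h : Q.truncate p D i =
      Function.update D p ((D p).filter fun t => Q.contribution p D t ≤ i) := by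
    funext j
    by_cases hj : j = p
    · subst hj
      simp [truncate, tsens_eq_contribution]
    · simp [truncate, hj]
  rw [h, answer_update]
  induction D p using Multiset.induction with
  | empty => simp
  | cons t B ih =>
    by_cases ht : Q.contribution p D t ≤ i
    · simp [ht, ih, truncContribution]
    · simp [ht, ih, truncContribution]

end JoinQuery

/-! ### Cascading deletion and joins -/

namespace Schema

variable {S : Schema}

theorem _root_.Multiset.eq_of_mem_of_card_le_one {α : Type*} {m : Multiset α}
    (hm : Multiset.card m ≤ 1) {a b : α} (ha : a ∈ m) (hb : b ∈ m) : a = b := by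
  obtain ⟨n, rfl⟩ := Multiset.exists_cons_of_mem ha
  obtain rfl : n = 0 := by simpa using hm
  exact (Multiset.mem_singleton.mp hb).symm

/-- In a valid instance, a tuple that takes part in a join refers only to tuples that take part in
the same join. -/
theorem proj_eq_of_transGen {D : S.Database} (hD : Valid D) {x : S.OutTuple}
    (hx : ∀ i, proj x i ∈ D i) {v u : S.TableTuple} (h : Relation.TransGen (RefersTo D) v u)
    (hv : v.2 = proj x v.1) : u.2 = proj x u.1 := by
  classical
  -- The referenced tuple and the projection of `x` to the parent agree on the key, since the child
  -- is a projection of the same `x`. Both lie in `D`, so the key property identifies them.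
  have step : ∀ {a b : S.TableTuple}, RefersTo D a b → a.2 = proj x a.1 → b.2 = proj x b.1 := by
    rintro _ _ ⟨f, hf, v', hv', u', hu', rfl, rfl, hk⟩ ha
    dsimp only at ha ⊢
    have hc := (hD f hf).1 (f.parentKey u')
    refine Multiset.eq_of_mem_of_card_le_one hc ?_ ?_
    · simpa using hu'
    · simp only [Multiset.mem_filter]
      refine ⟨hx _, ?_⟩
      rw [← hk, ha]
      rfl
  induction h with
  | single h => exact step h hv
  | tail _ h ih => exact step h ih

/-- In a valid instance, a tuple with dependent tuples has multiplicity one. -/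
theorem notMem_erase_of_transGen [∀ i, DecidableEq (S.Tuple i)] {D : S.Database} (hD : Valid D)
    {v : S.TableTuple} {p : S.Rel}
    {t : S.Tuple p} (h : Relation.TransGen (RefersTo D) v ⟨p, t⟩) : t ∉ (D p).erase t := by
  classical
  -- The last link of the chain supplies a foreign key whose parent relation is `p`; its key
  -- property bounds the multiplicity of `t`.
  obtain ⟨w, -, f, hf, v', hv', u', hu', -, hu, -⟩ := Relation.TransGen.tail'_iff.mp h
  obtain ⟨rfl, hu⟩ := Sigma.mk.inj_iff.mp hu
  obtain rfl := eq_of_heq hu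
  intro hmem
  have hc := (hD f hf).1 (f.parentKey t)
  rw [← Multiset.cons_erase hu', Multiset.filter_cons_of_pos (p := fun u => f.parentKey u = f.parentKey t) _ rfl,
    Multiset.card_cons] at hc
  have : t ∈ ((D f.parent).erase t).filter (fun u => f.parentKey u = f.parentKey t) := by
    simpa using hmem
  have := Multiset.card_pos_iff_exists_mem.mpr ⟨t, this⟩
  omega

theorem not_transGen_of_mem_erase [∀ i, DecidableEq (S.Tuple i)] {D : S.Database} (hD : Valid D)
    {x : S.OutTuple} (hx : ∀ i, proj x i ∈ D i) {p : S.Rel} {t : S.Tuple p}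
    (hp : proj x p ∈ (D p).erase t) (i : S.Rel) :
    ¬ Relation.TransGen (RefersTo D) ⟨i, proj x i⟩ ⟨p, t⟩ := by
  intro h
  have ht : t = proj x p := proj_eq_of_transGen hD hx h rfl
  rw [← ht] at hp
  exact notMem_erase_of_transGen hD h hp

open scoped Classical in
theorem cascadeDelete_self (D : S.Database) (p : S.Rel) (t : S.Tuple p) :
    cascadeDelete D ⟨p, t⟩ p = ((D p).erase t).filter
      (fun v => ¬ Relation.TransGen (RefersTo D) ⟨p, v⟩ ⟨p, t⟩) := by
  simp [cascadeDelete, removeTuple]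

open scoped Classical in
theorem cascadeDelete_of_ne (D : S.Database) (p : S.Rel) (t : S.Tuple p) {i : S.Rel} (hi : i ≠ p) :
    cascadeDelete D ⟨p, t⟩ i = (D i).filter
      (fun v => ¬ Relation.TransGen (RefersTo D) ⟨i, v⟩ ⟨p, t⟩) := by
  simp [cascadeDelete, removeTuple, hi]

end Schema

/-! ### Effect of cascading deletion on truncated answers -/

namespace JoinQuery

variable {S : Schema}

open scoped Classical in
theorem mult_update_singleton_ne_zero {Q : JoinQuery S} {D : S.Database} {p : S.Rel}
    {s : S.Tuple p} (hs : s ∈ D p) {x : S.OutTuple}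
    (h : Q.mult (Function.update D p {s}) x ≠ 0) : proj x p = s ∧ ∀ i, proj x i ∈ D i := by
  have hi : ∀ i, proj x i ∈ Function.update D p {s} i := fun i =>
    (Multiset.mem_filter.mp (Multiset.count_ne_zero.mp
      (Finset.prod_ne_zero_iff.mp h i (Finset.mem_univ i)))).1
  have hp : proj x p = s := by simpa using hi p
  refine ⟨hp, fun i => ?_⟩
  by_cases hip : i = p
  · subst hip
    rwa [hp]
  · simpa [hip] using hi i

open scoped Classical in
-- Chains of foreign keys may lead from `p` back to `p`, so the cascade can delete further tuples of
-- `p`. A join through such an `s` would force `s = t`, but a tuple with dependents has no second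
-- copy.
theorem contribution_eq_zero_of_transGen (Q : JoinQuery S) {D : S.Database} (hD : Valid D)
    {p : S.Rel} {t s : S.Tuple p} (hs : s ∈ (D p).erase t)
    (h : Relation.TransGen (RefersTo D) ⟨p, s⟩ ⟨p, t⟩) : Q.contribution p D s = 0 := by
  unfold contribution answer
  rw [Multiset.card_eq_zero, Multiset.eq_zero_iff_forall_notMem]
  intro x hx
  rw [← Multiset.count_ne_zero, count_result] at hx
  obtain ⟨rfl, hx'⟩ := mult_update_singleton_ne_zero (Multiset.mem_of_mem_erase hs) hx
  exact not_transGen_of_mem_erase hD hx' hs p h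

open scoped Classical in
theorem contribution_cascadeDelete (Q : JoinQuery S) {D : S.Database} (hD : Valid D)
    {p : S.Rel} {t s : S.Tuple p} (hs : s ∈ (D p).erase t) :
    Q.contribution p (cascadeDelete D ⟨p, t⟩) s = Q.contribution p D s := by
  unfold contribution answer
  congr 1
  ext x
  rw [count_result, count_result]
  -- Deletion cannot create joins, so a zero multiplicity stays zero. If it is nonzero, no
  -- projection of `x` depends on `t`, so the cascade changes none of its counts.
  by_cases h : Q.mult (Function.update D p {s}) x = 0
  · rw [h]
    rw [mult_update] at h ⊢
    rcases Nat.mul_eq_zero.mp h with h | h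
    · rw [h, zero_mul]
    · obtain ⟨i, hi, h⟩ := Finset.prod_eq_zero_iff.mp h
      rw [mul_eq_zero]
      refine Or.inr (Finset.prod_eq_zero hi (Nat.le_zero.mp (h ▸ Multiset.count_le_of_le _ ?_)))
      rw [cascadeDelete_of_ne _ _ _ (Finset.ne_of_mem_erase hi)]
      exact Multiset.filter_le_filter _ (Multiset.filter_le _ _)
  · obtain ⟨rfl, hx⟩ := mult_update_singleton_ne_zero (Multiset.mem_of_mem_erase hs) h
    rw [mult_update, mult_update]
    congr 1
    refine Finset.prod_congr rfl fun i hi => ?_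
    rw [cascadeDelete_of_ne _ _ _ (Finset.ne_of_mem_erase hi), Multiset.filter_comm]
    exact Multiset.count_filter_of_pos (not_transGen_of_mem_erase hD hx hs i)

/-- The truncated answer loses exactly the truncated contribution of the deleted tuple. -/
theorem answer_truncate_eq_add (Q : JoinQuery S) {D : S.Database} (hD : Valid D) {p : S.Rel}
    {t : S.Tuple p} (ht : t ∈ D p) (i : ℕ) :
    Q.answer (Q.truncate p D i) = Q.truncContribution p i D t +
      Q.answer (Q.truncate p (cascadeDelete D ⟨p, t⟩) i) := by
  classical
  have h1 : ((cascadeDelete D ⟨p, t⟩ p).map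
      (Q.truncContribution p i (cascadeDelete D ⟨p, t⟩))).sum =
      ((cascadeDelete D ⟨p, t⟩ p).map (Q.truncContribution p i D)).sum := by
    congr 1
    refine Multiset.map_congr rfl fun s hs => ?_
    rw [cascadeDelete_self] at hs
    unfold truncContribution
    rw [contribution_cascadeDelete Q hD (Multiset.mem_of_mem_filter hs)]
  rw [answer_truncate, answer_truncate, h1, cascadeDelete_self]
  nth_rewrite 1 [← Multiset.cons_erase ht]
  rw [Multiset.map_cons, Multiset.sum_cons]
  congr 1
  -- The other copies in `p` split into those that survive the cascade and those that depend on `t`;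
  -- the latter sum to zero.
  rw [← Multiset.filter_add_not
    (fun v => ¬ Relation.TransGen (RefersTo D) ⟨p, v⟩ ⟨p, t⟩) ((D p).erase t),
    Multiset.map_add, Multiset.sum_add]
  have h2 : (((((D p).erase t).filter fun v =>
      ¬ ¬ Relation.TransGen (RefersTo D) ⟨p, v⟩ ⟨p, t⟩)).map
      (Q.truncContribution p i D)).sum = 0 := by
    refine Multiset.sum_eq_zero fun n hn => ?_
    obtain ⟨s, hs, rfl⟩ := Multiset.mem_map.mp hn
    rw [Multiset.mem_filter, not_not] at hs
    simp [truncContribution, contribution_eq_zero_of_transGen Q hD hs.1 hs.2]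
  rw [h2, add_zero, Multiset.filter_add_not]

/-- Truncation at `i` bounds the sensitivity of the answer by `i`. -/
theorem abs_answer_truncate_sub_le (Q : JoinQuery S) {D : S.Database} (hD : Valid D) {p : S.Rel}
    {t : S.Tuple p} (ht : t ∈ D p) (i : ℕ) :
    |(Q.answer (Q.truncate p D i) : ℝ) -
      Q.answer (Q.truncate p (cascadeDelete D ⟨p, t⟩) i)| ≤ i := by
  rw [answer_truncate_eq_add Q hD ht i]
  push_cast
  rw [add_sub_cancel_right, abs_of_nonneg (Nat.cast_nonneg _)]
  exact_mod_cast truncContribution_le Q p i D t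

end JoinQuery

/-! ### Domination of measures, sequential composition and postprocessing -/

section Domination

open scoped ENNReal

variable {α β : Type*} [MeasurableSpace α] [MeasurableSpace β]

theorem MeasureTheory.Measure.lintegral_le_of_le_smul {μ ν : Measure α} {c : ℝ≥0∞}
    (h : μ ≤ c • ν) (f : α → ℝ≥0∞) : ∫⁻ x, f x ∂μ ≤ c * ∫⁻ x, f x ∂ν := by
  refine (lintegral_mono' h le_rfl).trans_eq ?_
  rw [lintegral_smul_measure, smul_eq_mul]

/-- Adaptive sequential composition: the second-stage bound is uniform over the first output, so it
comes out of the integral. -/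
theorem MeasureTheory.Measure.bind_le_smul {μ ν : Measure α} {κ η : α → Measure β} {c d : ℝ≥0∞}
    (h : μ ≤ c • ν) (hκ : Measurable κ) (hη : Measurable η) (hle : ∀ x, κ x ≤ d • η x) :
    μ.bind κ ≤ (c * d) • ν.bind η := by
  refine Measure.le_iff.mpr fun O hO => ?_
  rw [Measure.smul_apply, Measure.bind_apply hO hκ.aemeasurable,
    Measure.bind_apply hO hη.aemeasurable, smul_eq_mul, mul_assoc]
  refine (Measure.lintegral_le_of_le_smul h _).trans (mul_le_mul_right ?_ _)
  have hηO : Measurable fun x => η x O := (Measure.measurable_coe hO).comp hη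
  rw [← lintegral_const_mul _ hηO]
  exact lintegral_mono fun x => hle x O

theorem MeasureTheory.Measure.map_le_smul {μ ν : Measure α} {c : ℝ≥0∞} (h : μ ≤ c • ν)
    {f : α → β} (hf : Measurable f) : μ.map f ≤ c • ν.map f := by
  rw [← Measure.map_smul]
  exact Measure.map_mono h hf

theorem measurable_bind_of_measurable_uncurry {γ : Type*} [MeasurableSpace γ] (μ : Measure α)
    [SFinite μ] {f : γ → α → Measure β} (hf : Measurable (Function.uncurry f)) :
    Measurable fun c => μ.bind (f c) := by
  refine Measure.measurable_of_measurable_coe _ fun O hO => ?_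
  have h : (fun c => μ.bind (f c) O) = fun c => ∫⁻ a, f c a O ∂μ := by
    funext c
    exact Measure.bind_apply hO (hf.comp measurable_prodMk_left).aemeasurable
  rw [h]
  exact Measurable.lintegral_prod_right' (f := fun z : γ × α => f z.1 z.2 O)
    ((Measure.measurable_coe hO).comp hf)

theorem measurable_map_of_measurable_uncurry {γ : Type*} [MeasurableSpace γ] (μ : Measure α)
    [SFinite μ] {f : γ → α → β} (hf : Measurable (Function.uncurry f)) :
    Measurable fun c => μ.map (f c) := by
  have h : (fun c => μ.map (f c)) = fun c => μ.bind fun a => Measure.dirac (f c a) := by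
    funext c
    exact (Measure.bind_dirac_eq_map μ (hf.comp measurable_prodMk_left)).symm
  rw [h]
  exact measurable_bind_of_measurable_uncurry μ (Measure.measurable_dirac.comp hf)

end Domination

theorem isDP_of_le_smul {S : Schema} {Ω : Type*} [MeasurableSpace Ω] {p : S.Rel} {ε : ℝ}
    {M : S.Database → Measure Ω} (hM : ∀ D, IsProbabilityMeasure (M D))
    (h : ∀ (D : S.Database) (t : S.Tuple p), Valid D → t ∈ D p →
      M D ≤ ENNReal.ofReal (Real.exp ε) • M (cascadeDelete D ⟨p, t⟩) ∧
      M (cascadeDelete D ⟨p, t⟩) ≤ ENNReal.ofReal (Real.exp ε) • M D) : IsDP p ε M :=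
  ⟨hM, fun D t hD ht O _ => ⟨(h D t hD ht).1 O, (h D t hD ht).2 O⟩⟩

theorem ofReal_exp_mul_ofReal_exp (a b : ℝ) :
    ENNReal.ofReal (Real.exp a) * ENNReal.ofReal (Real.exp b) =
      ENNReal.ofReal (Real.exp (a + b)) := by
  rw [← ENNReal.ofReal_mul (Real.exp_nonneg _), Real.exp_add]

/-! ### The Laplace distribution -/

theorem measurable_laplace_density (b : ℝ) :
    Measurable fun x : ℝ => ENNReal.ofReal (1 / (2 * b) * Real.exp (-|x| / b)) := by
  fun_prop

theorem isProbabilityMeasure_laplace {b : ℝ} (hb : 0 < b) : IsProbabilityMeasure (laplace b) := by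
  have hIoi : IntegrableOn (fun x : ℝ => Real.exp (-|x| / b)) (Set.Ioi 0) := by
    refine (integrableOn_exp_mul_Ioi (a := -b⁻¹) (by simpa using hb) 0).congr_fun
      (fun x hx => ?_) measurableSet_Ioi
    dsimp only
    rw [abs_of_pos hx]
    congr 1
    ring
  have hIic : IntegrableOn (fun x : ℝ => Real.exp (-|x| / b)) (Set.Iic 0) := by
    refine (integrableOn_exp_mul_Iic (a := b⁻¹) (by simpa using hb) 0).congr_fun
      (fun x hx => ?_) measurableSet_Iic
    dsimp only
    rw [abs_of_nonpos hx]
    congr 1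
    ring
  have hint : Integrable fun x : ℝ => Real.exp (-|x| / b) := by
    rw [← integrableOn_univ, ← Set.Iic_union_Ioi (a := (0 : ℝ))]
    exact hIic.union hIoi
  have hval : ∫ x : ℝ, Real.exp (-|x| / b) = 2 * b := by
    rw [integral_comp_abs (f := fun x => Real.exp (-x / b))]
    have h : ∀ x : ℝ, -x / b = -b⁻¹ * x := fun x => by ring
    simp only [h]
    rw [integral_exp_mul_Ioi (by simpa using hb)]
    simp
  refine ⟨?_⟩
  rw [laplace, withDensity_apply _ MeasurableSet.univ, setLIntegral_univ,
    ← ofReal_integral_eq_lintegral_ofReal (hint.const_mul _)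
      (Filter.Eventually.of_forall fun x => by positivity), integral_const_mul, hval,
    one_div_mul_cancel (by positivity), ENNReal.ofReal_one]

instance sFinite_laplace (b : ℝ) : SFinite (laplace b) := by
  unfold laplace
  infer_instance

/-- Shifting the Laplace distribution of scale `b` by `a` costs a factor `exp (c)` if
`|a| / b ≤ c`. -/
theorem map_add_laplace_le {a b c : ℝ} (hb : 0 < b) (h : |a| ≤ c * b) :
    (laplace b).map (fun x => a + x) ≤ ENNReal.ofReal (Real.exp c) • laplace b := by
  refine Measure.le_iff.mpr fun O hO => ?_
  have hm := measurable_laplace_density b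
  rw [Measure.map_apply (measurable_const_add a) hO, Measure.smul_apply, smul_eq_mul, laplace,
    withDensity_apply _ (measurable_const_add a hO), withDensity_apply _ hO,
    ← lintegral_indicator hO, ← lintegral_indicator (measurable_const_add a hO),
    -- Translation invariance of Lebesgue measure turns the claim into a pointwise comparison of
    -- densities at `x` and `a + x`, settled by the triangle inequality.
    ← lintegral_add_left_eq_self (O.indicator _) a,
    ← lintegral_const_mul' _ _ ENNReal.ofReal_ne_top]
  refine lintegral_mono fun x => ?_
  by_cases hx : a + x ∈ O
  · rw [Set.indicator_of_mem (show x ∈ (fun x => a + x) ⁻¹' O from hx), Set.indicator_of_mem hx,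
      ← ENNReal.ofReal_mul (Real.exp_nonneg _)]
    refine ENNReal.ofReal_le_ofReal ?_
    rw [mul_left_comm, ← Real.exp_add]
    refine mul_le_mul_of_nonneg_left (Real.exp_le_exp.mpr ?_) (by positivity)
    have h1 : |a + x| ≤ |a| + |x| := abs_add_le a x
    rw [div_le_iff₀ hb, add_mul, div_mul_cancel₀ _ hb.ne']
    linarith
  · rw [Set.indicator_of_notMem (show x ∉ (fun x => a + x) ⁻¹' O from hx)]
    exact zero_le

theorem map_const_add_laplace_le {u v b c : ℝ} (hb : 0 < b) (h : |u - v| ≤ c * b) :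
    (laplace b).map (fun x => u + x) ≤
      ENNReal.ofReal (Real.exp c) • (laplace b).map (fun x => v + x) := by
  have h1 := Measure.map_le_smul (map_add_laplace_le hb h) (measurable_const_add v)
  rw [Measure.map_map (measurable_const_add v) (measurable_const_add _)] at h1
  convert h1 using 2
  funext x
  simp only [Function.comp_apply]
  ring

/-! ### The sparse vector technique -/

/-- The general parameter space `Z` lets threshold and queries vary jointly, as needed for
measurability in `Qhat` after integrating out `ρ`. -/
theorem measurable_svtScan {Z : Type*} [MeasurableSpace Z] (s : ℝ) (dflt : ℕ)
    (L : List (ℕ × (Z → ℝ))) (hL : ∀ e ∈ L, Measurable e.2) {θ : Z → ℝ} (hθ : Measurable θ) :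
    Measurable fun z => svtScan s (θ z) dflt (L.map fun e => (e.1, e.2 z)) := by
  induction L with
  | nil =>
    simp only [List.map_nil, svtScan]
    exact measurable_const
  | cons e L ih =>
    simp only [List.map_cons, svtScan]
    have ih := ih fun e he => hL e (List.mem_cons_of_mem _ he)
    have he : Measurable e.2 := hL e List.mem_cons_self
    have hA : MeasurableSet {w : Z × ℝ | e.2 w.1 + w.2 > θ w.1} :=
      measurableSet_lt (hθ.comp measurable_fst) ((he.comp measurable_fst).add measurable_snd)
    have hf : Measurable fun w : Z × ℝ => if e.2 w.1 + w.2 > θ w.1 then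
        (Measure.dirac e.1 : Measure ℕ) else
        svtScan s (θ w.1) dflt (L.map fun e => (e.1, e.2 w.1)) :=
      Measurable.ite hA measurable_const (ih.comp measurable_fst)
    exact measurable_bind_of_measurable_uncurry (γ := Z) (laplace s) hf

theorem measurable_svtScan_threshold (s : ℝ) (dflt : ℕ) (L : List (ℕ × ℝ)) :
    Measurable fun ρ => svtScan s (0 + ρ) dflt L := by
  have h := measurable_svtScan s dflt (L.map fun e => (e.1, fun _ : ℝ => e.2))
    (by simp only [List.mem_map]; rintro _ ⟨e, -, rfl⟩; exact measurable_const)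
    (θ := fun ρ => 0 + ρ) (measurable_const_add 0)
  simpa [Function.comp_def] using h

theorem measurable_svt (α β : ℝ) (dflt : ℕ) (L : List (ℕ × (ℝ → ℝ)))
    (hL : ∀ e ∈ L, Measurable e.2) :
    Measurable fun z => svt α β dflt (L.map fun e => (e.1, e.2 z)) := by
  have h := measurable_svtScan (Z := ℝ × ℝ) (2 / β) dflt
    (L.map fun e => (e.1, fun w : ℝ × ℝ => e.2 w.1))
    (by simp only [List.mem_map]; rintro _ ⟨e, he, rfl⟩; exact (hL e he).comp measurable_fst)
    (θ := fun w => 0 + w.2) (measurable_snd.const_add 0)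
  simp only [List.map_map, Function.comp_def] at h
  exact measurable_bind_of_measurable_uncurry (γ := ℝ) (laplace (1 / α)) h

theorem isProbabilityMeasure_svtScan {s : ℝ} (hs : 0 < s) (θ : ℝ) (dflt : ℕ) (L : List (ℕ × ℝ)) :
    IsProbabilityMeasure (svtScan s θ dflt L) := by
  induction L with
  | nil => exact Measure.dirac.isProbabilityMeasure
  | cons e L ih =>
    have := isProbabilityMeasure_laplace hs
    refine isProbabilityMeasure_bind (Measurable.aemeasurable ?_) (Filter.Eventually.of_forall fun ν => ?_)
    · exact Measurable.ite (measurableSet_lt measurable_const (measurable_const_add _))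
        measurable_const measurable_const
    · split_ifs
      · exact Measure.dirac.isProbabilityMeasure
      · exact ih

/-- Total probability over the first comparison: stop there, or continue with noise independent of
it. -/
theorem svtScan_cons_apply (s θ : ℝ) (dflt : ℕ) (e : ℕ × ℝ) (L : List (ℕ × ℝ)) (O : Set ℕ) :
    svtScan s θ dflt (e :: L) O =
      Measure.dirac e.1 O * (laplace s).map (fun ν => e.2 + ν) (Set.Ioi θ) +
      svtScan s θ dflt L O * (laplace s).map (fun ν => e.2 + ν) (Set.Iic θ) := by
  have hA : MeasurableSet {ν : ℝ | e.2 + ν > θ} :=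
    measurableSet_lt measurable_const (measurable_const_add _)
  have hf : Measurable fun ν : ℝ => if e.2 + ν > θ then (Measure.dirac e.1 : Measure ℕ) else
      svtScan s θ dflt L := Measurable.ite hA measurable_const measurable_const
  obtain ⟨i, q⟩ := e
  rw [svtScan, Measure.bind_apply (MeasurableSet.of_discrete) hf.aemeasurable,
    ← lintegral_add_compl _ hA, Measure.map_apply (measurable_const_add _) measurableSet_Ioi,
    Measure.map_apply (measurable_const_add _) measurableSet_Iic]
  congr 1
  · rw [setLIntegral_congr_fun (g := fun _ => Measure.dirac i O) hA fun ν hν => by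
      simp only [if_pos (show q + ν > θ from hν)], setLIntegral_const]
    rfl
  · rw [setLIntegral_congr_fun (g := fun _ => svtScan s θ dflt L O) hA.compl fun ν hν => by
      simp only [if_neg (show ¬ q + ν > θ from hν)], setLIntegral_const]
    congr 2
    ext ν
    exact not_lt (a := θ) (b := q + ν)

theorem svtScan_singleton_zero {s : ℝ} (θ : ℝ) {dflt : ℕ} (hd : dflt ≠ 0) (L : List (ℕ × ℝ))
    (hL : ∀ e ∈ L, e.1 ≠ 0) : svtScan s θ dflt L {0} = 0 := by
  induction L with
  | nil => simp [svtScan, hd]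
  | cons e L ih =>
    rw [svtScan_cons_apply, ih fun e he => hL e (List.mem_cons_of_mem _ he)]
    simp [hL e List.mem_cons_self]

/-- Moving the threshold up by `1` and all queries by at most `1` costs a factor `exp β`. -/
theorem svtScan_le {β : ℝ} (hβ : 0 < β) (θ : ℝ) (dflt : ℕ) {L L' : List (ℕ × ℝ)}
    (h : List.Forall₂ (fun e e' => e.1 = e'.1 ∧ |e.2 - e'.2| ≤ 1) L L') :
    svtScan (2 / β) θ dflt L ≤
      ENNReal.ofReal (Real.exp β) • svtScan (2 / β) (θ + 1) dflt L' := by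
  have h1 : 1 ≤ ENNReal.ofReal (Real.exp β) :=
    ENNReal.one_le_ofReal.mpr (Real.one_le_exp hβ.le)
  induction h with
  | nil =>
    refine Measure.le_iff.mpr fun O _ => ?_
    exact le_mul_of_one_le_left zero_le h1
  | @cons e e' L L' he _ ih =>
    obtain ⟨he1, he2⟩ := he
    have he2 := abs_le.mp he2
    refine Measure.le_iff.mpr fun O _ => ?_
    rw [Measure.smul_apply, smul_eq_mul, svtScan_cons_apply, svtScan_cons_apply, he1, mul_add]
    -- Only stopping pays. If the scan continues on `L`, then with the same noise it continues on
    -- `L'`, because the threshold rose by `1` and the query fell by at most `1`; the factor is then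
    -- left to the induction hypothesis.
    refine add_le_add ?_ ?_
    · rw [mul_left_comm]
      refine mul_le_mul_right ?_ _
      -- Threshold and query together shift the noise by at most `2 = β * (2 / β)`, which is what
      -- the scale `2 / β` is for.
      have h2 := map_const_add_laplace_le (u := e.2 + 1) (v := e'.2) (b := 2 / β) (c := β)
        (by positivity) (by
          rw [mul_div_cancel₀ _ hβ.ne', abs_le]
          constructor <;> linarith) (Set.Ioi (θ + 1))
      refine le_trans (le_of_eq ?_) h2
      rw [Measure.map_apply (measurable_const_add _) measurableSet_Ioi,
        Measure.map_apply (measurable_const_add _) measurableSet_Ioi]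
      congr 1
      ext ν
      simp only [Set.mem_preimage, Set.mem_Ioi]
      constructor <;> intro <;> linarith
    · rw [← mul_assoc]
      refine mul_le_mul' (ih O) ?_
      rw [Measure.map_apply (measurable_const_add _) measurableSet_Iic,
        Measure.map_apply (measurable_const_add _) measurableSet_Iic]
      refine measure_mono fun ν hν => ?_
      simp only [Set.mem_preimage, Set.mem_Iic] at hν ⊢
      linarith

/-- The raised threshold in `svtScan_le` is absorbed by shifting `ρ` by `1`, at cost `exp α` for
noise of scale `1 / α`. -/
theorem svt_le {α β : ℝ} (hα : 0 < α) (hβ : 0 < β) (dflt : ℕ) {L L' : List (ℕ × ℝ)}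
    (h : List.Forall₂ (fun e e' => e.1 = e'.1 ∧ |e.2 - e'.2| ≤ 1) L L') :
    svt α β dflt L ≤ ENNReal.ofReal (Real.exp (α + β)) • svt α β dflt L' := by
  refine Measure.le_iff.mpr fun O hO => ?_
  have hm := measurable_svtScan_threshold (2 / β) dflt L
  have hm' := measurable_svtScan_threshold (2 / β) dflt L'
  have hm'' : Measurable fun ρ => svtScan (2 / β) (0 + ρ) dflt L' O := (Measure.measurable_coe hO).comp hm'
  rw [Measure.smul_apply, smul_eq_mul, svt, svt, Measure.bind_apply hO hm.aemeasurable,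
    Measure.bind_apply hO hm'.aemeasurable, add_comm α β, ← ofReal_exp_mul_ofReal_exp, mul_assoc]
  calc ∫⁻ ρ, svtScan (2 / β) (0 + ρ) dflt L O ∂laplace (1 / α)
      ≤ ∫⁻ ρ, ENNReal.ofReal (Real.exp β) * svtScan (2 / β) (0 + (1 + ρ)) dflt L' O
          ∂laplace (1 / α) := by
        refine lintegral_mono fun ρ => ?_
        have := svtScan_le hβ (0 + ρ) dflt h O
        rwa [add_assoc, add_comm ρ 1] at this
    _ = ENNReal.ofReal (Real.exp β) * ∫⁻ ρ, svtScan (2 / β) (0 + ρ) dflt L' O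
          ∂((laplace (1 / α)).map fun ρ => 1 + ρ) := by
        rw [lintegral_map hm'' (measurable_const_add 1), lintegral_const_mul' _ _
          ENNReal.ofReal_ne_top]
    _ ≤ _ := by
        refine mul_le_mul_right (Measure.lintegral_le_of_le_smul (map_add_laplace_le ?_ ?_) _) _
        · positivity
        · rw [abs_one, mul_one_div_cancel hα.ne']

theorem isProbabilityMeasure_svt {α β : ℝ} (hα : 0 < α) (hβ : 0 < β) (dflt : ℕ)
    (L : List (ℕ × ℝ)) : IsProbabilityMeasure (svt α β dflt L) := by
  have := isProbabilityMeasure_laplace (one_div_pos.mpr hα)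
  exact isProbabilityMeasure_bind (measurable_svtScan_threshold _ _ _).aemeasurable
    (Filter.Eventually.of_forall fun ρ => isProbabilityMeasure_svtScan (by positivity) _ _ _)

theorem svt_singleton_zero (α β : ℝ) {dflt : ℕ} (hd : dflt ≠ 0) (L : List (ℕ × ℝ))
    (hL : ∀ e ∈ L, e.1 ≠ 0) : svt α β dflt L {0} = 0 := by
  rw [svt, Measure.bind_apply (MeasurableSet.singleton 0)
    (measurable_svtScan_threshold _ _ _).aemeasurable]
  simp [svtScan_singleton_zero _ hd L hL]

/-! ### The truncation mechanism -/

namespace JoinQuery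

variable {S : Schema}

theorem isProbabilityMeasure_noisyTruncated (Q : JoinQuery S) (p : S.Rel) {δ : ℝ} (hδ : 0 < δ)
    {i : ℕ} (hi : 1 ≤ i) (D : S.Database) : IsProbabilityMeasure (Q.noisyTruncated p δ i D) := by
  have : IsProbabilityMeasure (laplace (i / δ)) :=
    isProbabilityMeasure_laplace (div_pos (by exact_mod_cast hi) hδ)
  exact Measure.isProbabilityMeasure_map (measurable_const_add _).aemeasurable

/-- At scale `0` the density contains `1 / 0 = 0`, so the measure vanishes. The privacy inequality
thus holds at threshold `0` too, but total mass `1` requires `τ ≥ 1` almost surely, whence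
`findThreshold_ae_pos`. -/
theorem noisyTruncated_zero (Q : JoinQuery S) (p : S.Rel) (δ : ℝ) (D : S.Database) :
    Q.noisyTruncated p δ 0 D = 0 := by
  simp [noisyTruncated, laplace]

theorem noisyTruncated_le (Q : JoinQuery S) (p : S.Rel) {δ : ℝ} (hδ : 0 < δ) (i : ℕ)
    {D D' : S.Database}
    (h : |(Q.answer (Q.truncate p D i) : ℝ) - Q.answer (Q.truncate p D' i)| ≤ i) :
    Q.noisyTruncated p δ i D ≤ ENNReal.ofReal (Real.exp δ) • Q.noisyTruncated p δ i D' := by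
  rcases Nat.eq_zero_or_pos i with rfl | hi
  · simp [noisyTruncated_zero]
  · refine map_const_add_laplace_le (div_pos (by exact_mod_cast hi) hδ) (h.trans_eq ?_)
    rw [mul_div_cancel₀ _ hδ.ne']

theorem measurable_svt_svtQueries (Q : JoinQuery S) (p : S.Rel) (ℓ dflt : ℕ) (α β : ℝ)
    (D : S.Database) : Measurable fun Qhat => svt α β dflt (Q.svtQueries p ℓ D Qhat) := by
  have h := measurable_svt α β dflt ((List.range' 1 (ℓ - 1)).map fun i =>
    (i, fun Qhat : ℝ => ((Q.answer (Q.truncate p D i) : ℝ) - Qhat) / i))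
    (by simp only [List.mem_map]; rintro _ ⟨i, -, rfl⟩; fun_prop)
  simpa [svtQueries, Function.comp_def] using h

theorem measurable_map_svt_svtQueries (Q : JoinQuery S) (p : S.Rel) (ℓ dflt : ℕ) {α β : ℝ}
    (hα : 0 < α) (hβ : 0 < β) (D : S.Database) :
    Measurable fun Qhat : ℝ =>
      (svt α β dflt (Q.svtQueries p ℓ D Qhat)).map (fun τ => (Qhat, τ)) := by
  refine Measure.measurable_of_measurable_coe _ fun O hO => ?_
  -- The mass of `O` under the pushforward is the kernel mass of the section of `O` at `Qhat`, which
  -- is measurable in `Qhat`.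
  let κ : ProbabilityTheory.Kernel ℝ ℕ := ⟨_, Q.measurable_svt_svtQueries p ℓ dflt α β D⟩
  have : ProbabilityTheory.IsMarkovKernel κ := ⟨fun _ => isProbabilityMeasure_svt hα hβ _ _⟩
  have h := ProbabilityTheory.Kernel.measurable_kernel_prodMk_left (κ := κ) hO
  convert h using 2 with x
  exact Measure.map_apply measurable_prodMk_left hO

theorem svtQueries_forall₂ (Q : JoinQuery S) (p : S.Rel) (ℓ : ℕ) {D D' : S.Database}
    (h : ∀ i, |(Q.answer (Q.truncate p D i) : ℝ) - Q.answer (Q.truncate p D' i)| ≤ i)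
    (Qhat : ℝ) :
    List.Forall₂ (fun e e' => e.1 = e'.1 ∧ |e.2 - e'.2| ≤ 1)
      (Q.svtQueries p ℓ D Qhat) (Q.svtQueries p ℓ D' Qhat) := by
  unfold svtQueries
  rw [List.forall₂_map_left_iff, List.forall₂_map_right_iff, List.forall₂_same]
  refine fun i _ => ⟨rfl, ?_⟩
  -- The common `Qhat` cancels, and division by `i` normalizes the sensitivity to `1`.
  rw [← sub_div, sub_sub_sub_cancel_right, abs_div, Nat.abs_cast]
  exact div_le_one_of_le₀ (h i) (Nat.cast_nonneg i)

theorem findThreshold_le (Q : JoinQuery S) (p : S.Rel) (ℓ dflt : ℕ) {ε₁ ε₂ ε₃ : ℝ} (h₁ : 0 < ε₁)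
    (h₂ : 0 < ε₂) (h₃ : 0 < ε₃) {D D' : S.Database}
    (h : ∀ i, |(Q.answer (Q.truncate p D i) : ℝ) - Q.answer (Q.truncate p D' i)| ≤ i) :
    Q.findThreshold p ℓ dflt ε₁ ε₂ ε₃ D ≤
      ENNReal.ofReal (Real.exp (ε₁ + ε₂ + ε₃)) • Q.findThreshold p ℓ dflt ε₁ ε₂ ε₃ D' := by
  rw [add_assoc, ← ofReal_exp_mul_ofReal_exp]
  exact Measure.bind_le_smul (Q.noisyTruncated_le p h₁ ℓ (h ℓ))
    (Q.measurable_map_svt_svtQueries p ℓ dflt h₂ h₃ D)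
    (Q.measurable_map_svt_svtQueries p ℓ dflt h₂ h₃ D')
    fun Qhat => Measure.map_le_smul (svt_le h₂ h₃ dflt (Q.svtQueries_forall₂ p ℓ h Qhat))
      measurable_prodMk_left

theorem isProbabilityMeasure_findThreshold (Q : JoinQuery S) (p : S.Rel) {ℓ : ℕ} (hℓ : 1 ≤ ℓ)
    (dflt : ℕ) {ε₁ ε₂ ε₃ : ℝ} (h₁ : 0 < ε₁) (h₂ : 0 < ε₂) (h₃ : 0 < ε₃) (D : S.Database) :
    IsProbabilityMeasure (Q.findThreshold p ℓ dflt ε₁ ε₂ ε₃ D) := by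
  have := Q.isProbabilityMeasure_noisyTruncated p h₁ hℓ D
  refine isProbabilityMeasure_bind (Q.measurable_map_svt_svtQueries p ℓ dflt h₂ h₃ D).aemeasurable
    (Filter.Eventually.of_forall fun Qhat => ?_)
  have := isProbabilityMeasure_svt h₂ h₃ dflt (Q.svtQueries p ℓ D Qhat)
  exact Measure.isProbabilityMeasure_map measurable_prodMk_left.aemeasurable

theorem findThreshold_ae_pos (Q : JoinQuery S) (p : S.Rel) (ℓ : ℕ) {dflt : ℕ} (hd : 1 ≤ dflt)
    {ε₁ ε₂ ε₃ : ℝ} (h₂ : 0 < ε₂) (h₃ : 0 < ε₃) (D : S.Database) :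
    ∀ᵐ z ∂Q.findThreshold p ℓ dflt ε₁ ε₂ ε₃ D, 1 ≤ z.2 := by
  have hO : MeasurableSet {z : ℝ × ℕ | ¬ 1 ≤ z.2} :=
    measurable_snd (MeasurableSet.of_discrete (s := {n : ℕ | ¬ 1 ≤ n}))
  rw [ae_iff, findThreshold, Measure.bind_apply hO
    (Q.measurable_map_svt_svtQueries p ℓ dflt h₂ h₃ D).aemeasurable]
  refine (lintegral_congr fun Qhat => ?_).trans lintegral_zero
  rw [Measure.map_apply measurable_prodMk_left hO]
  have h0 : Prod.mk Qhat ⁻¹' {z : ℝ × ℕ | ¬ 1 ≤ z.2} = {0} := by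
    ext n
    simp
  rw [h0]
  refine svt_singleton_zero _ _ (by omega) _ fun e he => ?_
  obtain ⟨i, hi, rfl⟩ := List.mem_map.mp he
  have := (List.mem_range'_1.mp hi).1
  dsimp only
  omega

theorem measurable_map_noisyTruncated (Q : JoinQuery S) (p : S.Rel) (δ : ℝ) (D : S.Database) :
    Measurable fun z : ℝ × ℕ =>
      (Q.noisyTruncated p δ z.2 D).map (fun r => (z.1, z.2, r)) := by
  refine measurable_from_prod_countable_left fun n => ?_
  have : SFinite (Q.noisyTruncated p δ n D) := by
    unfold noisyTruncated
    infer_instance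
  exact measurable_map_of_measurable_uncurry (Q.noisyTruncated p δ n D)
    (f := fun (x : ℝ) r => (x, n, r)) (by
      refine measurable_fst.prodMk (measurable_const.prodMk measurable_snd))

theorem tsensDP_le (Q : JoinQuery S) (p : S.Rel) (ℓ dflt : ℕ) {ε₁ ε₂ ε₃ δ : ℝ} (h₁ : 0 < ε₁)
    (h₂ : 0 < ε₂) (h₃ : 0 < ε₃) (hδ : 0 < δ) {D D' : S.Database}
    (h : ∀ i, |(Q.answer (Q.truncate p D i) : ℝ) - Q.answer (Q.truncate p D' i)| ≤ i) :
    Q.tsensDP p ℓ dflt ε₁ ε₂ ε₃ δ D ≤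
      ENNReal.ofReal (Real.exp (ε₁ + ε₂ + ε₃ + δ)) • Q.tsensDP p ℓ dflt ε₁ ε₂ ε₃ δ D' := by
  rw [← ofReal_exp_mul_ofReal_exp]
  exact Measure.bind_le_smul (Q.findThreshold_le p ℓ dflt h₁ h₂ h₃ h)
    (Q.measurable_map_noisyTruncated p δ D) (Q.measurable_map_noisyTruncated p δ D')
    fun z => Measure.map_le_smul (Q.noisyTruncated_le p hδ z.2 (h z.2)) (by fun_prop)

theorem isProbabilityMeasure_tsensDP (Q : JoinQuery S) (p : S.Rel) {ℓ dflt : ℕ} (hℓ : 1 ≤ ℓ)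
    (hd : 1 ≤ dflt) {ε₁ ε₂ ε₃ δ : ℝ} (h₁ : 0 < ε₁) (h₂ : 0 < ε₂) (h₃ : 0 < ε₃) (hδ : 0 < δ)
    (D : S.Database) : IsProbabilityMeasure (Q.tsensDP p ℓ dflt ε₁ ε₂ ε₃ δ D) := by
  have := Q.isProbabilityMeasure_findThreshold p hℓ dflt h₁ h₂ h₃ D
  refine isProbabilityMeasure_bind (Q.measurable_map_noisyTruncated p δ D).aemeasurable ?_
  filter_upwards [Q.findThreshold_ae_pos p ℓ hd h₂ h₃ D] with z hz
  have := Q.isProbabilityMeasure_noisyTruncated p hδ hz D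
  exact Measure.isProbabilityMeasure_map (by fun_prop)

end JoinQuery

/-! ### Postprocessing and the main theorem -/

theorem IsDP.map {S : Schema} {Ω Ω' : Type*} [MeasurableSpace Ω] [MeasurableSpace Ω'] {p : S.Rel}
    {ε : ℝ} {M : S.Database → Measure Ω} (hM : IsDP p ε M) {f : Ω → Ω'} (hf : Measurable f) :
    IsDP p ε fun D => (M D).map f := by
  refine ⟨fun D => ?_, fun D t hD ht O hO => ?_⟩
  · have := hM.1 D
    exact Measure.isProbabilityMeasure_map hf.aemeasurable
  · rw [Measure.map_apply hf hO, Measure.map_apply hf hO]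
    exact hM.2 D t hD ht _ (hf hO)

theorem mainTheorem6 (S : Schema) (Q : JoinQuery S) (p : S.Rel)
    (ℓ dflt : ℕ) (hℓ : 1 ≤ ℓ) (hdflt : 1 ≤ dflt)
    (ε εtsens ε₁ ε₂ ε₃ : ℝ) (h₁ : 0 < ε₁) (h₂ : 0 < ε₂) (h₃ : 0 < ε₃)
    (hsum : ε₁ + ε₂ + ε₃ = εtsens) (hε : εtsens < ε) :
    -- the search for the threshold, with everything it releases, and its output `τ` alone
    IsDP p εtsens (Q.findThreshold p ℓ dflt ε₁ ε₂ ε₃) ∧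
    IsDP p εtsens (fun D => (Q.findThreshold p ℓ dflt ε₁ ε₂ ε₃ D).map (fun z => z.2)) ∧
    -- the noisy answer for a given threshold
    (∀ τ : ℕ, 1 ≤ τ → IsDP p (ε - εtsens) (Q.noisyTruncated p (ε - εtsens) τ)) ∧
    -- the combined mechanism, with everything it releases, and its final answer alone
    IsDP p ε (Q.tsensDP p ℓ dflt ε₁ ε₂ ε₃ (ε - εtsens)) ∧
    IsDP p ε (fun D => (Q.tsensDP p ℓ dflt ε₁ ε₂ ε₃ (ε - εtsens) D).map (fun z => z.2.2)) := by
  have hδ : 0 < ε - εtsens := sub_pos.mpr hε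
  have hs : ∀ (D : S.Database) (t : S.Tuple p), Valid D → t ∈ D p → ∀ i,
      |(Q.answer (Q.truncate p D i) : ℝ) -
        Q.answer (Q.truncate p (cascadeDelete D ⟨p, t⟩) i)| ≤ i :=
    fun D t hD ht => Q.abs_answer_truncate_sub_le hD ht
  have hs' : ∀ (D : S.Database) (t : S.Tuple p), Valid D → t ∈ D p → ∀ i,
      |(Q.answer (Q.truncate p (cascadeDelete D ⟨p, t⟩) i) : ℝ) -
        Q.answer (Q.truncate p D i)| ≤ i :=
    fun D t hD ht i => by rw [abs_sub_comm]; exact hs D t hD ht i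
  have hfind : IsDP p εtsens (Q.findThreshold p ℓ dflt ε₁ ε₂ ε₃) := by
    subst hsum
    exact isDP_of_le_smul (Q.isProbabilityMeasure_findThreshold p hℓ dflt h₁ h₂ h₃)
      fun D t hD ht => ⟨Q.findThreshold_le p ℓ dflt h₁ h₂ h₃ (hs D t hD ht),
        Q.findThreshold_le p ℓ dflt h₁ h₂ h₃ (hs' D t hD ht)⟩
  have htsens : IsDP p ε (Q.tsensDP p ℓ dflt ε₁ ε₂ ε₃ (ε - εtsens)) := by
    have hε' : ε = ε₁ + ε₂ + ε₃ + (ε - εtsens) := by rw [hsum]; ring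
    refine isDP_of_le_smul (Q.isProbabilityMeasure_tsensDP p hℓ hdflt h₁ h₂ h₃ hδ)
      fun D t hD ht => ?_
    have h := Q.tsensDP_le p ℓ dflt h₁ h₂ h₃ hδ (hs D t hD ht)
    have h' := Q.tsensDP_le p ℓ dflt h₁ h₂ h₃ hδ (hs' D t hD ht)
    rw [← hε'] at h h'
    exact ⟨h, h'⟩
  refine ⟨hfind, hfind.map measurable_snd, fun τ hτ => ?_, htsens,
    htsens.map (measurable_snd.comp measurable_snd)⟩
  exact isDP_of_le_smul (Q.isProbabilityMeasure_noisyTruncated p hδ hτ) fun D t hD ht =>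
    ⟨Q.noisyTruncated_le p hδ τ (hs D t hD ht τ), Q.noisyTruncated_le p hδ τ (hs' D t hD ht τ)⟩
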